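/- For a complex matrix $M$ let $\overline M$ denote its entrywise conjugate. A square matrix pencil $M+\lambda N$ is called regular if the polynomial $\det(M+\lambda N)$ in $\lambda$ is not identically zero; its spectrum is the set of its eigenvalues in $\mathbb C\cup\{\infty\}$, where $\lambda_0\in\mathbb C$ is an eigenvalue if $\det(M+\lambda_0N)=0$, and $\infty$ is an eigenvalue if $N$ is not invertible. Let $r,m,n\ge 1$, and let $A_i,C_i\in\mathbb C^{m\times m}$ and $B_i,D_i\in\mathbb C^{n\times n}$ for $i=1,\dots,r$. Then the system $$ \left\{\begin{array}{l} A_iX_iB_i-C_iX_{i+1}D_i=0,\qquad i=1,\dots,r-1,\\ A_rX_rB_r-C_r\overline{X_1}D_r=0, \end{array}\right. $$ in the unknowns $X_1,\dots,X_r\in\mathbb C^{m\times n}$, has only the trivial solution $X_1=\cdots=X_r=0$ if and only if the two $2r\times 2r$ block pencils $$ \begin{bmatrix} \lambda\overline{C_r}&\overline{A_r}&&&&&\\ &\ddots&\ddots&&&&\\ &&\lambda\overline{C_1}&\overline{A_1}&&&\\ &&&\lambda C_r&A_r&&\\ &&&&\ddots&\ddots&\\ &&&&&\lambda C_2&A_2\\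 A_1&&&&&&\lambda C_1 \end{bmatrix} \quad\text{and}\quad \begin{bmatrix} \lambda\overline{B_r}&\overline{D_{r-1}}&&&&&&\\ &\ddots&\ddots&&&&&\\ &&\lambda\overline{B_2}&\overline{D_1}&&&&\\ &&&\lambda\overline{B_1}&D_r&&&\\ &&&&\lambda B_r&D_{r-1}&&\\ &&&&&\ddots&\ddots&\\ &&&&&&\lambda B_2&D_1\\ \overline{D_r}&&&&&&&\lambda B_1 \end{bmatrix} $$ are both regular and have disjoint spectra. (All blocks not shown are zero. For $r=1$ the pencils are $\begin{bmatrix}\lambda\overline{C_1}&\overline{A_1}\\A_1&\lambda C_1\end{bmatrix}$ and $\begin{bmatrix}\lambda\overline{B_1}&D_1\\\overline{D_1}&\lambda B_1\end{bmatrix}$.) -/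

import Mathlib

/-- The square matrix pencil `const + λ • lin` with complex coefficients. -/
structure MatrixPencil (ι : Type*) where
  const : Matrix ι ι ℂ
  lin : Matrix ι ι ℂ

namespace MatrixPencil

variable {ι : Type*} [Fintype ι] [DecidableEq ι]

/-- The determinant of `const + λ • lin`, as a polynomial in `λ`. -/
noncomputable def detPoly (P : MatrixPencil ι) : Polynomial ℂ :=
  (P.const.map Polynomial.C + (Polynomial.X : Polynomial ℂ) • P.lin.map Polynomial.C).det

/-- A square pencil is regular if its determinant is not identically zero. -/
def IsRegular (P : MatrixPencil ι) : Prop :=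
  P.detPoly ≠ 0

/-- The spectrum, a subset of `ℂ ∪ {∞}`: the finite eigenvalues are the `μ` with
`det (const + μ • lin) = 0`, and `∞` is an eigenvalue if `lin` is not invertible. -/
def spectrum (P : MatrixPencil ι) : Set (OnePoint ℂ) :=
  {z | (∃ μ : ℂ, z = (μ : OnePoint ℂ) ∧ (P.const + μ • P.lin).det = 0) ∨
    (z = OnePoint.infty ∧ ¬ IsUnit P.lin)}

end MatrixPencil

/-- The entrywise complex conjugate of a matrix. -/
def matConj {ι κ : Type*} (M : Matrix ι κ ℂ) : Matrix ι κ ℂ :=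
  M.map (starRingEnd ℂ)

/-- The pencil of `N × N` blocks of size `k × k`, whose block row `p` has `λ • P p` on the
diagonal and `Q p` immediately to the right of it (in the first block column for the last
block row); all the other blocks vanish. -/
def cyclicPencil {N k : ℕ} (P Q : Fin N → Matrix (Fin k) (Fin k) ℂ) :
    MatrixPencil (Fin N × Fin k) where
  const := Matrix.of fun x y => if y.1 = finRotate N x.1 then Q x.1 x.2 y.2 else 0
  lin := Matrix.of fun x y => if y.1 = x.1 then P x.1 x.2 y.2 else 0

/-- From `M₁, …, M_r` (indexed from `0` in the code) the sequence of length `2r`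
`conj M_r, …, conj M₁, M_r, …, M₁`. -/
def conjStack {r k : ℕ} (M : Fin r → Matrix (Fin k) (Fin k) ℂ) (p : Fin (2 * r)) :
    Matrix (Fin k) (Fin k) ℂ :=
  if h : (p : ℕ) < r then matConj (M (Fin.rev ⟨p, h⟩))
  else M (Fin.rev ⟨(p : ℕ) - r, by omega⟩)

/-- The pencil with block rows `λ conj C_r, conj A_r; …; λ conj C₁, conj A₁; λ C_r, A_r; …;
λ C₂, A₂; A₁, …, λ C₁`. -/
def leftPencil {r m : ℕ} (A C : Fin r → Matrix (Fin m) (Fin m) ℂ) :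
    MatrixPencil (Fin (2 * r) × Fin m) :=
  cyclicPencil (conjStack C) (conjStack A)

/-- The pencil with block rows `λ conj B_r, conj D_{r-1}; …; λ conj B₂, conj D₁;
λ conj B₁, D_r; λ B_r, D_{r-1}; …; λ B₂, D₁; conj D_r, …, λ B₁`. Here the off-diagonal block in
block column `q` is the `q`-th term of `conj D_r, …, conj D₁, D_r, …, D₁`. -/
def rightPencil {r n : ℕ} (B D : Fin r → Matrix (Fin n) (Fin n) ℂ) :
    MatrixPencil (Fin (2 * r) × Fin n) :=
  cyclicPencil (conjStack B) (fun p => conjStack D (finRotate (2 * r) p))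

/-- `X` solves `A_i X_i B_i - C_i X_{i+1} D_i = 0` for `i = 1, …, r-1` and
`A_r X_r B_r - C_r conj(X₁) D_r = 0` (indices shifted to start at `0`). -/
def IsConjPeriodicSolution {r m n : ℕ} (hr : 0 < r)
    (A C : Fin r → Matrix (Fin m) (Fin m) ℂ) (B D : Fin r → Matrix (Fin n) (Fin n) ℂ)
    (X : Fin r → Matrix (Fin m) (Fin n) ℂ) : Prop :=
  (∀ i j : Fin r, (j : ℕ) = (i : ℕ) + 1 → A i * X i * B i - C i * X j * D i = 0) ∧
  ∀ i : Fin r, (i : ℕ) + 1 = r → A i * X i * B i - C i * matConj (X ⟨0, hr⟩) * D i = 0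

/-!
The system with conjugation is only `ℝ`-linear. Applying the equations and their conjugates to
independent unknowns `X_1, …, X_r` and `X_{r+1}, …, X_{2r}` gives a `ℂ`-linear cyclic system of
length `N = 2r`, and one system has a nontrivial solution if and only if the other has
(`forall_isConjPeriodicSolution_eq_zero_iff`). It remains to treat a cyclic system
`A_i X_i B_i = C_i X_{i+1} D_i` with indices modulo `N`.

If the pencils are regular with disjoint spectra, the `X_i` are placed as blocks in one large
matrix, which then solves a generalized Sylvester equation for the two pencils. Inverting the
pencils at a common regular point gives an ordinary Sylvester equation, for two matrices with
coprime characteristic polynomials (`MatrixPencil.eq_zero_of_disjoint_spectrum`).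

Conversely, null vectors `u` and `v` of the two pencils at a common eigenvalue other than `0` and
`∞` give the solution `X_i = u_i v_i` consisting of rank one matrices. It could vanish only if `u`
has a zero component; then the components of `u` can be rescaled independently of the closing
relation of the cycle, so that the first pencil is singular. For the remaining cases, singularity
of a linear system is a closed condition on the coefficients, so they may be perturbed
(`IsSingularSystem.of_frequently`). If the first pencil is singular, the coefficients of the other
one are perturbed to invertible ones, which provides an eigenvalue with a vector `v` without zero
components (`IsSingularSystem.of_forall_eigenvalue`). If `0` is a common eigenvalue, some `A_q` and
some `D_s` are not invertible; after perturbing all the other coefficients to invertible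
ones, a solution supported on the indices from `s + 1` to `q` is explicit
(`IsSingularSystem.of_det_eq_zero_of_invertible`). Transposing exchanges the roles of the two
pencils, and of `0` and `∞`.
-/

open Matrix Filter Topology

/-! ### Recursion along a cycle -/

/-- Going once around the cycle from `q`, a sequence may be prescribed by any first order
recursion; the only relation not imposed is the one closing the cycle at `q`. -/
lemma exists_cyclic_chain {N : ℕ} {β : Type*} (f : Fin N → β → β) (q : Fin N) (e : β) :
    ∃ a : Fin N → β, a q = e ∧ ∀ i, finRotate N i ≠ q → a (finRotate N i) = f i (a i) := by
  obtain _ | M := N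
  · exact q.elim0
  refine ⟨fun i => Nat.rec e (fun k x => f (q + Fin.ofNat (M + 1) k) x) (i - q).val, by simp, ?_⟩
  intro i hi
  rw [finRotate_apply] at hi ⊢
  have h : (i + 1 - q).val = (i - q).val + 1 := by
    rw [show i + 1 - q = (i - q) + 1 by abel, Fin.val_add_one, if_neg]
    intro h
    apply hi
    have h1 : (i - q) + 1 = 0 := by rw [h]; simp
    rw [← sub_eq_zero, ← h1]
    abel
  simp only [h]
  congr 1
  simp

lemma exists_cyclic_chain_backward {N : ℕ} {β : Type*} (f : Fin N → β → β) (q : Fin N) (e : β) :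
    ∃ a : Fin N → β, a q = e ∧ ∀ i, i ≠ q → a i = f i (a (finRotate N i)) := by
  obtain _ | M := N
  · exact q.elim0
  obtain ⟨a, ha, h⟩ := exists_cyclic_chain (fun j x => f (-j - 1) x) (-q) e
  refine ⟨fun i => a (-i), ha, fun i hi => ?_⟩
  have h2 := h (-(i + 1))
  simp only [finRotate_apply] at h2 ⊢
  rw [show -(i + 1) + 1 = -i by abel, show -(-(i + 1)) - 1 = i by abel] at h2
  exact h2 (by simpa using hi)

lemma forall_of_finRotate {N : ℕ} {P : Fin N → Prop} (h : ∀ i, P i → P (finRotate N i))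
    {j : Fin N} (hj : P j) (k : Fin N) : P k := by
  obtain _ | M := N
  · exact j.elim0
  have key : ∀ l : ℕ, P (j + Fin.ofNat (M + 1) l) := by
    intro l
    induction l with
    | zero => simpa using hj
    | succ l ih =>
      have := h _ ih
      rw [finRotate_apply] at this
      rwa [add_assoc, show Fin.ofNat (M + 1) l + 1 = Fin.ofNat (M + 1) (l + 1) by
        simp [Fin.ext_iff, Fin.val_add]] at this
  simpa using key (k - j).val

/-! ### Perturbation arguments -/

/-- Singular matrices form a closed set: a continuous family of endomorphisms that is singular
for parameters arbitrarily close to `0` is singular at `0`. -/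
lemma exists_ne_zero_of_frequently {E : Type*} [AddCommGroup E] [Module ℂ E] [TopologicalSpace E]
    [IsTopologicalAddGroup E] [ContinuousSMul ℂ E] [T2Space E] [FiniteDimensional ℂ E]
    (S : ℂ → E →ₗ[ℂ] E) (hS : ∀ x, Continuous fun ε => S ε x)
    (h : ∃ᶠ ε in 𝓝[≠] 0, ∃ x, x ≠ 0 ∧ S ε x = 0) : ∃ x, x ≠ 0 ∧ S 0 x = 0 := by
  classical
  set b := Module.finBasis ℂ E
  have hdet : ∀ ε, (∃ x, x ≠ 0 ∧ S ε x = 0) ↔ LinearMap.det (S ε) = 0 := by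
    intro ε
    constructor
    · rintro ⟨x, hx, h0⟩
      by_contra hd
      have := (LinearMap.isUnit_iff_ker_eq_bot (S ε)).1
        ((LinearMap.isUnit_iff_isUnit_det _).2 (isUnit_iff_ne_zero.2 hd))
      exact hx (LinearMap.ker_eq_bot'.1 this x h0)
    · intro hd
      obtain ⟨x, hx, h0⟩ := Submodule.exists_mem_ne_zero_of_ne_bot
        (LinearMap.bot_lt_ker_of_det_eq_zero hd).ne'
      exact ⟨x, h0, hx⟩
  have hcont : Continuous fun ε => LinearMap.det (S ε) := by
    simp only [← LinearMap.det_toMatrix b]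
    refine Continuous.matrix_det (continuous_matrix fun i j => ?_)
    simp only [LinearMap.toMatrix_apply]
    exact (LinearMap.continuous_of_finiteDimensional (b.coord i)).comp (hS (b j))
  simp only [hdet] at h ⊢
  by_contra h0
  exact h (((hcont.continuousAt (x := 0)).eventually_ne h0).filter_mono nhdsWithin_le_nhds)

lemma eventually_isUnit_det_add_smul_one {k : ℕ} (M : Matrix (Fin k) (Fin k) ℂ) :
    ∀ᶠ ε : ℂ in 𝓝[≠] 0, IsUnit (M + ε • (1 : Matrix (Fin k) (Fin k) ℂ)).det := by
  have hfin : {ε : ℂ | (-M).charpoly.IsRoot ε}.Finite :=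
    Polynomial.finite_setOfPred_isRoot (Matrix.charpoly_monic _).ne_zero
  have := (nhdsNE_le_cofinite (0 : ℂ)) hfin.compl_mem_cofinite
  filter_upwards [this] with ε hε
  rw [isUnit_iff_ne_zero]
  intro h
  apply hε
  change Polynomial.eval ε _ = 0
  rw [Matrix.eval_charpoly, ← h, sub_neg_eq_add, add_comm, Matrix.smul_one_eq_diagonal]
  rfl

/-! ### Cyclic systems of generalized Sylvester equations -/

section Cyclic

variable {N m n : ℕ}

/-- `X` solves the homogeneous system `A_i X_i B_i = C_i X_{i+1} D_i`, with indices modulo `N`. -/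
def IsCyclicSolution (A C : Fin N → Matrix (Fin m) (Fin m) ℂ)
    (B D : Fin N → Matrix (Fin n) (Fin n) ℂ) (X : Fin N → Matrix (Fin m) (Fin n) ℂ) : Prop :=
  ∀ i, A i * X i * B i = C i * X (finRotate N i) * D i

/-- The homogeneous cyclic system has a nontrivial solution. -/
def IsSingularSystem (A C : Fin N → Matrix (Fin m) (Fin m) ℂ)
    (B D : Fin N → Matrix (Fin n) (Fin n) ℂ) : Prop :=
  ∃ X, X ≠ 0 ∧ IsCyclicSolution A C B D X

/-- `lam` is an eigenvalue of the cyclic pencil with blocks `A_i` and `-lam C_i`: there is a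
nonzero `u` with `A_i u_i = lam C_i u_{i+1}`. -/
def IsCyclicEigenvalue (A C : Fin N → Matrix (Fin m) (Fin m) ℂ) (lam : ℂ) : Prop :=
  ∃ u : Fin N → Fin m → ℂ, u ≠ 0 ∧ ∀ i, A i *ᵥ u i = lam • C i *ᵥ u (finRotate N i)

variable {A C : Fin N → Matrix (Fin m) (Fin m) ℂ} {B D : Fin N → Matrix (Fin n) (Fin n) ℂ}

lemma IsSingularSystem.transpose
    (h : IsSingularSystem (fun i => (B i)ᵀ) (fun i => (D i)ᵀ) (fun i => (A i)ᵀ) fun i => (C i)ᵀ) :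
    IsSingularSystem A C B D := by
  obtain ⟨X, hX, h⟩ := h
  refine ⟨fun i => (X i)ᵀ, fun h0 => hX ?_, fun i => ?_⟩
  · funext i
    simpa using congrFun h0 i
  · have := congrArg Matrix.transpose (h i)
    simpa [Matrix.transpose_mul, Matrix.mul_assoc] using this

lemma IsSingularSystem.of_frequently {A C : ℂ → Fin N → Matrix (Fin m) (Fin m) ℂ}
    {B D : ℂ → Fin N → Matrix (Fin n) (Fin n) ℂ} (hA : Continuous A) (hC : Continuous C)
    (hB : Continuous B) (hD : Continuous D)
    (h : ∃ᶠ ε in 𝓝[≠] 0, IsSingularSystem (A ε) (C ε) (B ε) (D ε)) :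
    IsSingularSystem (A 0) (C 0) (B 0) (D 0) := by
  let S : ℂ → (Fin N → Matrix (Fin m) (Fin n) ℂ) →ₗ[ℂ] (Fin N → Matrix (Fin m) (Fin n) ℂ) :=
    fun ε =>
      { toFun := fun X i => A ε i * X i * B ε i - C ε i * X (finRotate N i) * D ε i
        map_add' := fun X Y => by
          funext i
          simp only [Pi.add_apply, Matrix.mul_add, Matrix.add_mul]
          abel
        map_smul' := fun c X => by
          funext i
          simp [smul_sub] }
  have hS : ∀ ε X, S ε X = 0 ↔ IsCyclicSolution (A ε) (C ε) (B ε) (D ε) X := by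
    intro ε X
    rw [funext_iff]
    exact forall_congr' fun i => sub_eq_zero
  have hcont : ∀ X, Continuous fun ε => S ε X := by
    intro X
    refine continuous_pi fun i => ?_
    have hA' := (continuous_apply i).comp hA
    have hB' := (continuous_apply i).comp hB
    have hC' := (continuous_apply i).comp hC
    have hD' := (continuous_apply i).comp hD
    exact ((hA'.matrix_mul continuous_const).matrix_mul hB').sub
      ((hC'.matrix_mul continuous_const).matrix_mul hD')
  have := exists_ne_zero_of_frequently S hcont
  simp only [hS] at this
  exact this h

lemma vecMulVec_ne_zero_of_ne_zero {x : Fin m → ℂ} {y : Fin n → ℂ} (hx : x ≠ 0) (hy : y ≠ 0) :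
    vecMulVec x y ≠ 0 := by
  obtain ⟨i, hi⟩ := Function.ne_iff.1 hx
  obtain ⟨j, hj⟩ := Function.ne_iff.1 hy
  exact fun h => mul_ne_zero hi hj (congrFun (congrFun h i) j)

lemma vecMulVec_zero_right (x : Fin m → ℂ) : vecMulVec x (0 : Fin n → ℂ) = 0 := by
  ext i j
  simp [vecMulVec_apply]

/-- Rank one matrices `u_i v_i` built from right and left eigenvectors solve the system. -/
lemma IsSingularSystem.of_eigenvectors {lam : ℂ} {u : Fin N → Fin m → ℂ} {v : Fin N → Fin n → ℂ}
    (hu : ∀ i, A i *ᵥ u i = lam • C i *ᵥ u (finRotate N i))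
    (hv : ∀ i, v (finRotate N i) ᵥ* D i = lam • v i ᵥ* B i)
    {j : Fin N} (huj : u j ≠ 0) (hvj : v j ≠ 0) : IsSingularSystem A C B D := by
  refine ⟨fun i => vecMulVec (u i) (v i), fun h => ?_, fun i => ?_⟩
  · have := congrFun h j
    exact vecMulVec_ne_zero_of_ne_zero huj hvj this
  · rw [mul_vecMulVec, vecMulVec_mul, mul_vecMulVec, vecMulVec_mul, hu, hv, smul_vecMulVec,
      vecMulVec_smul]

lemma mulVec_ne_zero_of_invertible {k : ℕ} {M : Matrix (Fin k) (Fin k) ℂ} (hM : IsUnit M.det)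
    {x : Fin k → ℂ} (hx : x ≠ 0) : M *ᵥ x ≠ 0 := fun h =>
  (isUnit_iff_ne_zero.1 hM) (exists_mulVec_eq_zero_iff.1 ⟨x, hx, h⟩)

lemma vecMul_ne_zero_of_invertible {k : ℕ} {M : Matrix (Fin k) (Fin k) ℂ} (hM : IsUnit M.det)
    {x : Fin k → ℂ} (hx : x ≠ 0) : x ᵥ* M ≠ 0 := fun h =>
  (isUnit_iff_ne_zero.1 hM) (exists_vecMul_eq_zero_iff.1 ⟨x, hx, h⟩)

/-- For invertible `B_i` and `D_i` the cyclic pencil of row vectors has a nonzero finite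
eigenvalue, and all components of an eigenvector for it are nonzero. -/
lemma exists_left_eigenvector_of_invertible (hN : 0 < N) (hn : 0 < n)
    (hB : ∀ i, IsUnit (B i).det) (hD : ∀ i, IsUnit (D i).det) :
    ∃ lam : ℂ, lam ≠ 0 ∧ ∃ v : Fin N → Fin n → ℂ, (∀ i, v i ≠ 0) ∧
      ∀ i, v (finRotate N i) ᵥ* D i = lam • v i ᵥ* B i := by
  have : NeZero N := ⟨hN.ne'⟩
  have : NeZero n := ⟨hn.ne'⟩
  let K : Module.End ℂ (Fin N → Fin n → ℂ) :=
    { toFun := fun v i => v (finRotate N i) ᵥ* D i ᵥ* (B i)⁻¹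
      map_add' := fun v w => by funext i; simp [add_vecMul]
      map_smul' := fun c v => by funext i; simp [smul_vecMul] }
  obtain ⟨lam, hlam⟩ := Module.End.exists_eigenvalue K
  obtain ⟨v, hv⟩ := hlam.exists_hasEigenvector
  have hBinv : ∀ i, IsUnit ((B i)⁻¹).det := fun i => Matrix.isUnit_nonsing_inv_det _ (hB i)
  have hK : ∀ i, v (finRotate N i) ᵥ* D i ᵥ* (B i)⁻¹ = lam • v i := fun i =>
    congrFun hv.apply_eq_smul i
  obtain ⟨j, hj⟩ := Function.ne_iff.1 hv.2
  have h0 : lam ≠ 0 := by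
    rintro rfl
    obtain ⟨i, rfl⟩ := (finRotate N).surjective j
    refine vecMul_ne_zero_of_invertible (hBinv i) (vecMul_ne_zero_of_invertible (hD i) hj) ?_
    rw [hK, zero_smul]
  refine ⟨lam, h0, v, ?_, fun i => ?_⟩
  · refine forall_of_finRotate (P := fun i => v i ≠ 0) (fun i hi hi' => ?_) hj
    have := hK i
    rw [hi', zero_vecMul, zero_vecMul] at this
    exact smul_ne_zero h0 hi this.symm
  · rw [← smul_vecMul, ← hK i, vecMul_vecMul _ (B i)⁻¹, Matrix.nonsing_inv_mul _ (hB i), vecMul_one]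

/-- A singular cyclic pencil makes the system singular: after a small perturbation the pencil
of row vectors has an eigenvalue with an eigenvector without zero components, which
can be combined with any eigenvector of the singular pencil for the same eigenvalue. -/
lemma IsSingularSystem.of_forall_eigenvalue (hN : 0 < N) (hn : 0 < n)
    (h : ∀ lam : ℂ, lam ≠ 0 → IsCyclicEigenvalue A C lam) : IsSingularSystem A C B D := by
  have key : IsSingularSystem A C (fun i => B i + (0 : ℂ) • (1 : Matrix (Fin n) (Fin n) ℂ))
      (fun i => D i + (0 : ℂ) • (1 : Matrix (Fin n) (Fin n) ℂ)) := by
    refine IsSingularSystem.of_frequently (A := fun _ => A) (C := fun _ => C)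
      (B := fun ε i => B i + ε • (1 : Matrix (Fin n) (Fin n) ℂ))
      (D := fun ε i => D i + ε • (1 : Matrix (Fin n) (Fin n) ℂ)) continuous_const continuous_const
      (by fun_prop) (by fun_prop) (Eventually.frequently ?_)
    have hB := eventually_all.2 fun i => eventually_isUnit_det_add_smul_one (B i)
    have hD := eventually_all.2 fun i => eventually_isUnit_det_add_smul_one (D i)
    filter_upwards [hB, hD] with ε hB hD
    obtain ⟨lam, h0, v, hv, hv'⟩ := exists_left_eigenvector_of_invertible hN hn hB hD
    obtain ⟨u, hu, hu'⟩ := h lam h0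
    obtain ⟨j, hj⟩ := Function.ne_iff.1 hu
    exact .of_eigenvectors hu' hv' hj (hv j)
  simpa using key

/-- An eigenvector with a zero component can be rescaled along the cycle to an eigenvector
for any other nonzero eigenvalue. -/
lemma IsCyclicEigenvalue.of_zero_component {lam mu : ℂ} (hlam : lam ≠ 0) (hmu : mu ≠ 0)
    {u : Fin N → Fin m → ℂ} (hu : u ≠ 0)
    (hu' : ∀ i, A i *ᵥ u i = lam • C i *ᵥ u (finRotate N i)) {q : Fin N} (hq : u q = 0) :
    IsCyclicEigenvalue A C mu := by
  obtain ⟨t, -, ht⟩ := exists_cyclic_chain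
    (fun _ (x : {x : ℂ // x ≠ 0}) =>
      (⟨x * lam / mu, div_ne_zero (mul_ne_zero x.2 hlam) hmu⟩ : {x : ℂ // x ≠ 0})) q ⟨1, one_ne_zero⟩
  refine ⟨fun i => (t i : ℂ) • u i, fun h => hu ?_, fun i => ?_⟩
  · funext i
    exact (smul_eq_zero.1 (congrFun h i)).resolve_left (t i).2
  · rw [mulVec_smul, hu']
    by_cases hi : finRotate N i = q
    · simp [hi, hq]
    · simp only [ht i hi, mulVec_smul, smul_smul]
      congr 1
      field_simp

/-- A common nonzero finite eigenvalue makes the system singular. -/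
lemma IsSingularSystem.of_common_eigenvalue (hN : 0 < N) (hn : 0 < n) {lam : ℂ} (hlam : lam ≠ 0)
    (hu : IsCyclicEigenvalue A C lam) {v : Fin N → Fin n → ℂ} (hv : v ≠ 0)
    (hv' : ∀ i, v (finRotate N i) ᵥ* D i = lam • v i ᵥ* B i) : IsSingularSystem A C B D := by
  obtain ⟨u, hu, hu'⟩ := hu
  obtain ⟨j, hj⟩ := Function.ne_iff.1 hv
  by_cases hq : u j = 0
  · exact .of_forall_eigenvalue hN hn fun mu hmu => .of_zero_component hlam hmu hu hu' hq
  · exact .of_eigenvectors hu' hv' hq hj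

/-- If all coefficients other than `A_q` and `D_s` are invertible, a solution supported on the
indices from `s + 1` to `q` is built from a vector killed by `A_q`, continued
backward from `q`, and a row vector killed by `D_s`, continued forward from `s + 1`. -/
lemma IsSingularSystem.of_det_eq_zero_of_invertible {q s : Fin N} (hq : (A q).det = 0)
    (hs : (D s).det = 0) (hA : ∀ i ≠ q, IsUnit (A i).det) (hB : ∀ i, IsUnit (B i).det)
    (hC : ∀ i, IsUnit (C i).det) (hD : ∀ i ≠ s, IsUnit (D i).det) :
    IsSingularSystem A C B D := by
  classical
  obtain ⟨x, hx, hxA⟩ := exists_mulVec_eq_zero_iff.2 hq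
  obtain ⟨y, hy, hyD⟩ := exists_vecMul_eq_zero_iff.2 hs
  obtain ⟨a, haq, ha⟩ := exists_cyclic_chain_backward
    (fun i (z : {z : Fin m → ℂ // z ≠ 0}) => if hi : i = q then z else
      (⟨(A i)⁻¹ *ᵥ (C i *ᵥ z),
        mulVec_ne_zero_of_invertible (Matrix.isUnit_nonsing_inv_det _ (hA i hi))
        (mulVec_ne_zero_of_invertible (hC i) z.2)⟩ : {z : Fin m → ℂ // z ≠ 0})) q ⟨x, hx⟩
  obtain ⟨b, hbs, hb⟩ := exists_cyclic_chain
    (fun i (z : {z : Fin n → ℂ // z ≠ 0}) => if hi : i = s then z else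
      (⟨(z : Fin n → ℂ) ᵥ* B i ᵥ* (D i)⁻¹,
        vecMul_ne_zero_of_invertible (Matrix.isUnit_nonsing_inv_det _ (hD i hi))
        (vecMul_ne_zero_of_invertible (hB i) z.2)⟩ : {z : Fin n → ℂ // z ≠ 0}))
      (finRotate N s) ⟨y, hy⟩
  -- `c` is the indicator function of the cyclic interval from `s + 1` to `q`.
  obtain ⟨c, hcs, hc⟩ := exists_cyclic_chain (fun i (z : ℂ) => if i = q then 0 else z)
    (finRotate N s) 1
  have ha' : ∀ i ≠ q, A i *ᵥ (a i : Fin m → ℂ) = C i *ᵥ (a (finRotate N i) : Fin m → ℂ) := by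
    intro i hi
    rw [ha i hi, dif_neg hi, mulVec_mulVec, Matrix.mul_nonsing_inv _ (hA i hi), one_mulVec]
  have haq' : A q *ᵥ (a q : Fin m → ℂ) = 0 := by rw [haq]; exact hxA
  have hb' : ∀ i ≠ s, (b (finRotate N i) : Fin n → ℂ) ᵥ* D i = (b i : Fin n → ℂ) ᵥ* B i := by
    intro i hi
    rw [hb i ((finRotate N).injective.ne hi), dif_neg hi, vecMul_vecMul _ (D i)⁻¹,
      Matrix.nonsing_inv_mul _ (hD i hi), vecMul_one]
  have hbs' : (b (finRotate N s) : Fin n → ℂ) ᵥ* D s = 0 := by rw [hbs]; exact hyD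
  have hc' : ∀ i ≠ s, i ≠ q → c (finRotate N i) = c i := fun i hi hi' => by
    rw [hc i ((finRotate N).injective.ne hi), if_neg hi']
  have hcq : q ≠ s → c (finRotate N q) = 0 := fun h => by
    rw [hc q ((finRotate N).injective.ne h), if_pos rfl]
  -- Once `c` vanishes after `q`, it stays zero up to `s`.
  have hc0 : q ≠ s → c s = 0 := by
    intro h
    by_contra h0
    refine h0 (forall_of_finRotate (P := fun i => c i = 0) (fun i hi => ?_) (hcq h) s)
    have his : i ≠ s := by rintro rfl; exact h0 hi
    by_cases hiq : i = q
    · rw [hiq, hcq h]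
    · rw [hc' i his hiq, hi]
  refine ⟨fun i => c i • vecMulVec (a i : Fin m → ℂ) (b i), fun h => ?_, fun i => ?_⟩
  · have := congrFun h (finRotate N s)
    rw [hcs, one_smul] at this
    exact vecMulVec_ne_zero_of_ne_zero (a _).2 (b _).2 this
  · simp only [Matrix.mul_smul, Matrix.smul_mul, mul_vecMulVec, vecMulVec_mul]
    by_cases hiq : i = q
    · subst hiq
      by_cases his : i = s
      · subst his
        simp [-finRotate_apply, haq', hbs', vecMulVec_zero_right]
      · simp [-finRotate_apply, haq', hcq his]
    · by_cases his : i = s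
      · subst his
        simp [-finRotate_apply, hc0 (Ne.symm hiq), hbs', vecMulVec_zero_right]
      · rw [hc' i his hiq, ha' i hiq, hb' i his]

/-- A common eigenvalue `0` makes the system singular: some `A_q` and some `D_s` are not
invertible, and all the other coefficients may be perturbed to invertible ones. -/
lemma IsSingularSystem.of_det_eq_zero {q s : Fin N} (hq : (A q).det = 0) (hs : (D s).det = 0) :
    IsSingularSystem A C B D := by
  classical
  have key : IsSingularSystem
      (fun i => A i + (if i = q then (0 : ℂ) else 0) • (1 : Matrix (Fin m) (Fin m) ℂ))
      (fun i => C i + (0 : ℂ) • (1 : Matrix (Fin m) (Fin m) ℂ))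
      (fun i => B i + (0 : ℂ) • (1 : Matrix (Fin n) (Fin n) ℂ))
      (fun i => D i + (if i = s then (0 : ℂ) else 0) • (1 : Matrix (Fin n) (Fin n) ℂ)) := by
    have hcont : ∀ {k : ℕ} (M : Fin N → Matrix (Fin k) (Fin k) ℂ) (p : Fin N),
        Continuous fun (ε : ℂ) i => M i + (if i = p then (0 : ℂ) else ε) •
          (1 : Matrix (Fin k) (Fin k) ℂ) := by
      intro k M p
      refine continuous_pi fun i => ?_
      split_ifs <;> fun_prop
    refine IsSingularSystem.of_frequently
      (A := fun ε i => A i + (if i = q then (0 : ℂ) else ε) • (1 : Matrix (Fin m) (Fin m) ℂ))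
      (C := fun ε i => C i + ε • (1 : Matrix (Fin m) (Fin m) ℂ))
      (B := fun ε i => B i + ε • (1 : Matrix (Fin n) (Fin n) ℂ))
      (D := fun ε i => D i + (if i = s then (0 : ℂ) else ε) • (1 : Matrix (Fin n) (Fin n) ℂ))
      (hcont A q) (by fun_prop) (by fun_prop) (hcont D s) (Eventually.frequently ?_)
    filter_upwards [eventually_all.2 fun i => eventually_isUnit_det_add_smul_one (A i),
      eventually_all.2 fun i => eventually_isUnit_det_add_smul_one (B i),
      eventually_all.2 fun i => eventually_isUnit_det_add_smul_one (C i),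
      eventually_all.2 fun i => eventually_isUnit_det_add_smul_one (D i)] with ε hA hB hC hD
    exact .of_det_eq_zero_of_invertible (q := q) (s := s) (by simpa using hq) (by simpa using hs)
      (fun i hi => by simpa [hi] using hA i) hB hC (fun i hi => by simpa [hi] using hD i)
  simpa using key

end Cyclic

/-! ### The generalized Sylvester equation for two pencils -/

section Sylvester

variable {ι κ : Type*} [Fintype ι] [DecidableEq ι] [Fintype κ] [DecidableEq κ]

/-- Sylvester's theorem: a matrix intertwining two matrices without common eigenvalue is zero. -/
lemma eq_zero_of_intertwines {M : Matrix ι ι ℂ} {K : Matrix κ κ ℂ} {X : Matrix ι κ ℂ}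
    (h : M * X = X * K) (hMK : ∀ z, M.charpoly.eval z = 0 → K.charpoly.eval z ≠ 0) : X = 0 := by
  have hpow : ∀ l : ℕ, M ^ l * X = X * K ^ l := by
    intro l
    induction l with
    | zero => simp
    | succ l ih => rw [pow_succ, Matrix.mul_assoc, h, ← Matrix.mul_assoc, ih, Matrix.mul_assoc,
        ← pow_succ]
  have hpoly : ∀ p : Polynomial ℂ, Polynomial.aeval M p * X = X * Polynomial.aeval K p := by
    intro p
    induction p using Polynomial.induction_on' with
    | add p q hp hq => rw [map_add, map_add, Matrix.add_mul, Matrix.mul_add, hp, hq]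
    | monomial l a =>
      simp only [Polynomial.aeval_monomial, Algebra.algebraMap_eq_smul_one, smul_mul_assoc, one_mul,
        Matrix.smul_mul, Matrix.mul_smul, hpow]
  have hco : IsCoprime M.charpoly K.charpoly := by
    rw [Polynomial.isCoprime_iff_aeval_ne_zero_of_isAlgClosed ℂ ℂ]
    intro z
    simp only [Polynomial.coe_aeval_eq_eval]
    exact or_iff_not_imp_left.2 fun hz => hMK z (not_not.1 hz)
  obtain ⟨a, b, hab⟩ := hco
  have h1 := congrArg (Polynomial.aeval M) hab
  rw [map_add, map_mul, Matrix.aeval_self_charpoly, mul_zero, zero_add, map_mul, map_one] at h1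
  calc X = (Polynomial.aeval M b * Polynomial.aeval M K.charpoly) * X := by rw [h1, Matrix.one_mul]
    _ = 0 := by rw [Matrix.mul_assoc, hpoly, Matrix.aeval_self_charpoly, Matrix.mul_zero,
      Matrix.mul_zero]

namespace MatrixPencil

lemma eval_detPoly (P : MatrixPencil ι) (μ : ℂ) :
    P.detPoly.eval μ = (P.const + μ • P.lin).det := by
  rw [detPoly, ← Polynomial.coe_evalRingHom, RingHom.map_det]
  congr 1
  ext i j
  simp
  ring

lemma det_eq_zero_of_not_isRegular {P : MatrixPencil ι} (h : ¬ P.IsRegular) (μ : ℂ) :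
    (P.const + μ • P.lin).det = 0 := by
  rw [← eval_detPoly, not_not.1 h, Polynomial.eval_zero]

/-- The eigenvalues `z` of `(const + μ • lin)⁻¹ * lin` correspond to the points `μ - z⁻¹` of the
spectrum of the pencil, with `z = 0` corresponding to `∞`. -/
lemma mem_spectrum_of_eval_charpoly_eq_zero {P : MatrixPencil ι} {μ z : ℂ}
    (hμ : (P.const + μ • P.lin).det ≠ 0)
    (hz : ((P.const + μ • P.lin)⁻¹ * P.lin).charpoly.eval z = 0) :
    (if z = 0 then OnePoint.infty else ((μ - z⁻¹ : ℂ) : OnePoint ℂ)) ∈ P.spectrum := by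
  have hu := isUnit_iff_ne_zero.2 hμ
  have hdet : (z • (P.const + μ • P.lin) - P.lin).det = 0 := by
    have : z • (P.const + μ • P.lin) - P.lin = (P.const + μ • P.lin) *
        (scalar ι z - (P.const + μ • P.lin)⁻¹ * P.lin) := by
      rw [Matrix.mul_sub, ← Matrix.mul_assoc, Matrix.mul_nonsing_inv _ hu, Matrix.one_mul,
        Matrix.scalar_apply, ← Matrix.smul_one_eq_diagonal, Matrix.mul_smul, Matrix.mul_one]
    rw [this, Matrix.det_mul, ← Matrix.eval_charpoly, hz, mul_zero]
  split_ifs with h0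
  · refine Or.inr ⟨rfl, fun hlin => ?_⟩
    rw [h0, zero_smul, zero_sub, Matrix.det_neg] at hdet
    exact (isUnit_iff_ne_zero.1 ((Matrix.isUnit_iff_isUnit_det _).1 hlin))
      ((mul_eq_zero.1 hdet).resolve_left (pow_ne_zero _ (by norm_num)))
  · refine Or.inl ⟨_, rfl, ?_⟩
    have : P.const + (μ - z⁻¹) • P.lin = z⁻¹ • (z • (P.const + μ • P.lin) - P.lin) := by
      rw [smul_sub, smul_smul, inv_mul_cancel₀ h0, one_smul, sub_smul, add_sub_assoc]
    rw [this, Matrix.det_smul, hdet, mul_zero]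

/-- The generalized Sylvester equation of two regular pencils with disjoint spectra has only the
trivial solution. Both pencils are invertible at some `μ`; adding `μ • (P.lin * X * Q.lin)` to
both sides turns the equation into an ordinary Sylvester equation. -/
theorem eq_zero_of_disjoint_spectrum {P : MatrixPencil ι} {Q : MatrixPencil κ} (hP : P.IsRegular)
    (hQ : Q.IsRegular) (hPQ : Disjoint P.spectrum Q.spectrum) {X : Matrix ι κ ℂ}
    (hX : P.const * X * Q.lin = P.lin * X * Q.const) : X = 0 := by
  obtain ⟨μ, hμ⟩ : ∃ μ, (P.detPoly * Q.detPoly).eval μ ≠ 0 := by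
    by_contra! h
    exact mul_ne_zero hP hQ (Polynomial.funext fun μ => by simpa using h μ)
  rw [Polynomial.eval_mul, eval_detPoly, eval_detPoly] at hμ
  obtain ⟨hμP, hμQ⟩ := mul_ne_zero_iff.1 hμ
  have huP := isUnit_iff_ne_zero.2 hμP
  have huQ := isUnit_iff_ne_zero.2 hμQ
  have hshift : (P.const + μ • P.lin) * X * Q.lin = P.lin * X * (Q.const + μ • Q.lin) := by
    simp only [Matrix.add_mul, Matrix.mul_add, Matrix.smul_mul, Matrix.mul_smul, hX]
  refine eq_zero_of_intertwines (M := (P.const + μ • P.lin)⁻¹ * P.lin)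
    (K := Q.lin * (Q.const + μ • Q.lin)⁻¹) ?_ fun z hzP hzQ => ?_
  · calc (P.const + μ • P.lin)⁻¹ * P.lin * X
        = (P.const + μ • P.lin)⁻¹ * (P.lin * X * (Q.const + μ • Q.lin)) *
            (Q.const + μ • Q.lin)⁻¹ := by
          rw [Matrix.mul_assoc _ (P.lin * X * _), Matrix.mul_nonsing_inv_cancel_right _ _ huQ,
            Matrix.mul_assoc]
      _ = X * (Q.lin * (Q.const + μ • Q.lin)⁻¹) := by
          rw [← hshift, Matrix.mul_assoc _ X, Matrix.nonsing_inv_mul_cancel_left _ _ huP,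
            Matrix.mul_assoc]
  · rw [Matrix.charpoly_mul_comm] at hzQ
    exact Set.disjoint_left.1 hPQ (mem_spectrum_of_eval_charpoly_eq_zero hμP hzP)
      (mem_spectrum_of_eval_charpoly_eq_zero hμQ hzQ)

end MatrixPencil

end Sylvester

/-! ### Cyclic pencils -/

section CyclicPencil

variable {N k m n : ℕ}

section Blocks

variable (P Q : Fin N → Matrix (Fin k) (Fin k) ℂ) (w : Fin N × Fin k → ℂ) (p : Fin N) (a : Fin k)

lemma cyclicPencil_const_mulVec :
    ((cyclicPencil P Q).const *ᵥ w) (p, a) = (Q p *ᵥ fun b => w (finRotate N p, b)) a := by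
  simp [cyclicPencil, mulVec, dotProduct, Fintype.sum_prod_type, Finset.sum_ite_irrel,
    -finRotate_apply]

lemma cyclicPencil_lin_mulVec :
    ((cyclicPencil P Q).lin *ᵥ w) (p, a) = (P p *ᵥ fun b => w (p, b)) a := by
  simp [cyclicPencil, mulVec, dotProduct, Fintype.sum_prod_type, Finset.sum_ite_irrel]

lemma vecMul_cyclicPencil_const :
    (w ᵥ* (cyclicPencil P Q).const) (finRotate N p, a) = ((fun b => w (p, b)) ᵥ* Q p) a := by
  simp [cyclicPencil, vecMul, dotProduct, Fintype.sum_prod_type, Finset.sum_ite_irrel,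
    -finRotate_apply]

lemma vecMul_cyclicPencil_lin :
    (w ᵥ* (cyclicPencil P Q).lin) (p, a) = ((fun b => w (p, b)) ᵥ* P p) a := by
  simp [cyclicPencil, vecMul, dotProduct, Fintype.sum_prod_type, Finset.sum_ite_irrel]

end Blocks

/-- Right null vectors of a cyclic pencil, block row by block row. -/
lemma exists_of_det_cyclicPencil_eq_zero {P Q : Fin N → Matrix (Fin k) (Fin k) ℂ} {s t : ℂ}
    (h : (s • (cyclicPencil P Q).const + t • (cyclicPencil P Q).lin).det = 0) :
    ∃ u : Fin N → Fin k → ℂ, u ≠ 0 ∧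
      ∀ p, s • Q p *ᵥ u (finRotate N p) + t • P p *ᵥ u p = 0 := by
  obtain ⟨w, hw, h⟩ := exists_mulVec_eq_zero_iff.2 h
  refine ⟨fun p a => w (p, a), fun h0 => hw ?_, fun p => ?_⟩
  · funext x
    exact congrFun (congrFun h0 x.1) x.2
  · funext a
    have := congrFun h (p, a)
    simpa only [add_mulVec, smul_mulVec, Pi.zero_apply, Pi.add_apply, Pi.smul_apply,
      cyclicPencil_const_mulVec, cyclicPencil_lin_mulVec] using this

/-- Left null vectors of a cyclic pencil, block column by block column. -/
lemma exists_vecMul_of_det_cyclicPencil_eq_zero {P Q : Fin N → Matrix (Fin k) (Fin k) ℂ} {s t : ℂ}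
    (h : (s • (cyclicPencil P Q).const + t • (cyclicPencil P Q).lin).det = 0) :
    ∃ v : Fin N → Fin k → ℂ, v ≠ 0 ∧
      ∀ p, s • v p ᵥ* Q p + t • v (finRotate N p) ᵥ* P (finRotate N p) = 0 := by
  obtain ⟨w, hw, h⟩ := exists_vecMul_eq_zero_iff.2 h
  refine ⟨fun p a => w (p, a), fun h0 => hw ?_, fun p => ?_⟩
  · funext x
    exact congrFun (congrFun h0 x.1) x.2
  · funext a
    have := congrFun h (finRotate N p, a)
    simpa only [vecMul_add, vecMul_smul, Pi.zero_apply, Pi.add_apply, Pi.smul_apply,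
      vecMul_cyclicPencil_const, vecMul_cyclicPencil_lin] using this

lemma exists_det_eq_zero_of_det_const_eq_zero {P Q : Fin N → Matrix (Fin k) (Fin k) ℂ}
    (h : (cyclicPencil P Q).const.det = 0) : ∃ p, (Q p).det = 0 := by
  obtain ⟨u, hu, h⟩ := exists_of_det_cyclicPencil_eq_zero (P := P) (Q := Q) (s := 1) (t := 0)
    (by simpa using h)
  obtain ⟨j, hj⟩ := Function.ne_iff.1 hu
  obtain ⟨p, rfl⟩ := (finRotate N).surjective j
  exact ⟨p, exists_mulVec_eq_zero_iff.1 ⟨_, hj, by simpa [-finRotate_apply] using h p⟩⟩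

lemma exists_det_eq_zero_of_det_lin_eq_zero {P Q : Fin N → Matrix (Fin k) (Fin k) ℂ}
    (h : (cyclicPencil P Q).lin.det = 0) : ∃ p, (P p).det = 0 := by
  obtain ⟨u, hu, h⟩ := exists_of_det_cyclicPencil_eq_zero (P := P) (Q := Q) (s := 0) (t := 1)
    (by simpa using h)
  obtain ⟨j, hj⟩ := Function.ne_iff.1 hu
  exact ⟨j, exists_mulVec_eq_zero_iff.1 ⟨_, hj, by simpa using h j⟩⟩

variable {A C : Fin N → Matrix (Fin m) (Fin m) ℂ} {B D : Fin N → Matrix (Fin n) (Fin n) ℂ}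

/-- Placing `X_s` in the block `(s + 1, s)` turns the cyclic system into a generalized Sylvester
equation for the two cyclic pencils. The pencils run through the indices backward, so in their
numbering the equations are `A_{p+1} X_{p+1} B_{p+1} = C_{p+1} X_p D_{p+1}`; this is the
cyclic system with `A` exchanged with `C`, and `B` with `D`. -/
lemma eq_zero_of_isCyclicSolution (hL : (cyclicPencil C A).IsRegular)
    (hR : (cyclicPencil B fun p => D (finRotate N p)).IsRegular)
    (hd : Disjoint (cyclicPencil C A).spectrum
      (cyclicPencil B fun p => D (finRotate N p)).spectrum)
    {X : Fin N → Matrix (Fin m) (Fin n) ℂ}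
    (hX : IsCyclicSolution (fun p => C (finRotate N p)) (fun p => A (finRotate N p))
      (fun p => D (finRotate N p)) (fun p => B (finRotate N p)) X) : X = 0 := by
  let Z : Matrix (Fin N × Fin m) (Fin N × Fin n) ℂ :=
    Matrix.of fun x y => if x.1 = finRotate N y.1 then X y.1 x.2 y.2 else 0
  have hZ : Z = 0 := by
    refine MatrixPencil.eq_zero_of_disjoint_spectrum hL hR hd ?_
    ext ⟨p, a⟩ ⟨s, b⟩
    obtain ⟨s, rfl⟩ := (finRotate N).surjective s
    have h1 : ((cyclicPencil C A).const * Z * (cyclicPencil B fun p => D (finRotate N p)).lin)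
        (p, a) (finRotate N s, b) =
        if p = finRotate N s then
          (A p * X p * B p) a b else 0 := by
      have hrow : (fun c => ((cyclicPencil C A).const * Z) (p, a) (finRotate N s, c)) =
          if p = finRotate N s then (A p * X p) a else 0 := by
        funext c
        refine (cyclicPencil_const_mulVec C A (fun x => Z x (finRotate N s, c)) p a).trans ?_
        split_ifs with h
        · subst h
          simp [Z, Matrix.mul_apply, mulVec, dotProduct, -finRotate_apply]
        · simp [Z, h, mulVec, dotProduct, (finRotate N).injective.eq_iff, -finRotate_apply]
      refine (vecMul_cyclicPencil_lin B (fun p => D (finRotate N p))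
        (((cyclicPencil C A).const * Z) (p, a)) (finRotate N s) b).trans ?_
      rw [hrow]
      split_ifs with h
      · rw [h]
        rfl
      · simp
    have h2 : ((cyclicPencil C A).lin * Z * (cyclicPencil B fun p => D (finRotate N p)).const)
        (p, a) (finRotate N s, b) =
        if p = finRotate N s then
          (C p * X s * D p) a b else 0 := by
      have hrow : (fun c => ((cyclicPencil C A).lin * Z) (p, a) (s, c)) =
          if p = finRotate N s then (C p * X s) a else 0 := by
        funext c
        refine (cyclicPencil_lin_mulVec C A (fun x => Z x (s, c)) p a).trans ?_
        split_ifs with h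
        · subst h
          simp [Z, Matrix.mul_apply, mulVec, dotProduct, -finRotate_apply]
        · simp [Z, h, mulVec, dotProduct, -finRotate_apply]
      refine (vecMul_cyclicPencil_const B (fun p => D (finRotate N p))
        (((cyclicPencil C A).lin * Z) (p, a)) s b).trans ?_
      rw [hrow]
      split_ifs with h
      · rw [h]
        rfl
      · simp
    rw [h1, h2]
    split_ifs with h
    · subst h
      exact (congrFun (congrFun (hX s) a) b).symm
    · rfl
  funext s
  ext a b
  have := congrFun (congrFun hZ (finRotate N s, a)) (s, b)
  simpa [Z, -finRotate_apply] using this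

/-- A singular pencil or a common eigenvalue makes the cyclic system singular. The eigenvalue `μ`
of the pencils is the eigenvalue `-μ⁻¹` in the sense of `IsCyclicEigenvalue`, so that the
points `0` and `∞` need a separate argument. -/
lemma isSingularSystem_of_pencils (hN : 0 < N) (hm : 0 < m) (hn : 0 < n)
    (h : ¬ ((cyclicPencil C A).IsRegular ∧
      (cyclicPencil B fun p => D (finRotate N p)).IsRegular ∧
      Disjoint (cyclicPencil C A).spectrum
        (cyclicPencil B fun p => D (finRotate N p)).spectrum)) :
    IsSingularSystem (fun p => C (finRotate N p)) (fun p => A (finRotate N p))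
      (fun p => D (finRotate N p)) (fun p => B (finRotate N p)) := by
  have hleft : ∀ lam : ℂ, lam ≠ 0 →
      ((cyclicPencil C A).const + (-lam⁻¹) • (cyclicPencil C A).lin).det = 0 →
      IsCyclicEigenvalue (fun p => C (finRotate N p)) (fun p => A (finRotate N p)) lam := by
    intro lam hlam hdet
    obtain ⟨u, hu, h⟩ := exists_of_det_cyclicPencil_eq_zero (s := 1) (by rwa [one_smul])
    refine ⟨fun p => u (finRotate N p), fun h0 => hu ?_, fun p => ?_⟩
    · funext p
      obtain ⟨p, rfl⟩ := (finRotate N).surjective p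
      exact congrFun h0 p
    · have := h (finRotate N p)
      rw [one_smul, neg_smul, add_neg_eq_zero] at this
      rw [this, smul_smul, mul_inv_cancel₀ hlam, one_smul]
  have hright : ∀ lam : ℂ, lam ≠ 0 →
      ((cyclicPencil B fun p => D (finRotate N p)).const +
        (-lam⁻¹) • (cyclicPencil B fun p => D (finRotate N p)).lin).det = 0 →
      ∃ v : Fin N → Fin n → ℂ, v ≠ 0 ∧
        ∀ p, v (finRotate N p) ᵥ* B (finRotate N p) = lam • v p ᵥ* D (finRotate N p) := by
    intro lam hlam hdet
    obtain ⟨v, hv, h⟩ := exists_vecMul_of_det_cyclicPencil_eq_zero (s := 1) (by rwa [one_smul])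
    refine ⟨v, hv, fun p => ?_⟩
    have := h p
    rw [one_smul, neg_smul, add_neg_eq_zero] at this
    rw [this, smul_smul, mul_inv_cancel₀ hlam, one_smul]
  -- A singular pencil has every `lam` as an eigenvalue; for row vectors the system is transposed,
  -- which replaces `lam` by its inverse.
  by_cases hL : (cyclicPencil C A).IsRegular
  swap
  · exact .of_forall_eigenvalue hN hn fun lam hlam =>
      hleft lam hlam (MatrixPencil.det_eq_zero_of_not_isRegular hL _)
  by_cases hR : (cyclicPencil B fun p => D (finRotate N p)).IsRegular
  swap
  · refine .transpose (.of_forall_eigenvalue hN hm fun lam hlam => ?_)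
    obtain ⟨v, hv, hv'⟩ := hright lam⁻¹ (inv_ne_zero hlam)
      (MatrixPencil.det_eq_zero_of_not_isRegular hR _)
    refine ⟨v, hv, fun p => ?_⟩
    rw [mulVec_transpose, mulVec_transpose, hv', smul_smul, mul_inv_cancel₀ hlam, one_smul]
  have hd : ¬ Disjoint (cyclicPencil C A).spectrum
      (cyclicPencil B fun p => D (finRotate N p)).spectrum := fun hd => h ⟨hL, hR, hd⟩
  obtain ⟨z, hzL, hzR⟩ := Set.not_disjoint_iff.1 hd
  obtain ⟨μ, rfl, hμ⟩ | ⟨rfl, hinf⟩ := hzL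
  · obtain ⟨ν, hν, hμ'⟩ | ⟨hν, -⟩ := hzR
    · obtain rfl := OnePoint.coe_injective hν
      by_cases h0 : μ = 0
      · rw [h0, zero_smul, add_zero] at hμ hμ'
        obtain ⟨q, hq⟩ := exists_det_eq_zero_of_det_const_eq_zero hμ
        obtain ⟨s, hs⟩ := exists_det_eq_zero_of_det_const_eq_zero hμ'
        obtain ⟨q, rfl⟩ := (finRotate N).surjective q
        exact .transpose (.of_det_eq_zero (q := s) (s := q) (by rwa [det_transpose])
          (by rwa [det_transpose]))
      · have hinv : (-(-μ⁻¹)⁻¹) = μ := by simp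
        have hne : -μ⁻¹ ≠ 0 := neg_ne_zero.2 (inv_ne_zero h0)
        obtain ⟨v, hv, hv'⟩ := hright (-μ⁻¹) hne (by rwa [hinv])
        exact .of_common_eigenvalue hN hn hne (hleft (-μ⁻¹) hne (by rwa [hinv])) hv hv'
    · exact absurd hν (OnePoint.coe_ne_infty μ)
  · obtain ⟨ν, hν, -⟩ | ⟨-, hinf'⟩ := hzR
    · exact absurd hν.symm (OnePoint.coe_ne_infty ν)
    · rw [Matrix.isUnit_iff_isUnit_det, isUnit_iff_ne_zero, not_not] at hinf hinf'
      obtain ⟨q, hq⟩ := exists_det_eq_zero_of_det_lin_eq_zero hinf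
      obtain ⟨s, hs⟩ := exists_det_eq_zero_of_det_lin_eq_zero hinf'
      obtain ⟨q, rfl⟩ := (finRotate N).surjective q
      obtain ⟨s, rfl⟩ := (finRotate N).surjective s
      exact .of_det_eq_zero (q := q) (s := s) hq hs

end CyclicPencil

/-! ### Conjugation -/

section Conjugation

lemma matConj_add {ι κ : Type*} (M N : Matrix ι κ ℂ) : matConj (M + N) = matConj M + matConj N := by
  ext; simp [matConj]

lemma matConj_smul {ι κ : Type*} (c : ℂ) (M : Matrix ι κ ℂ) :
    matConj (c • M) = (starRingEnd ℂ c) • matConj M := by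
  ext; simp [matConj]

lemma matConj_mul {ι κ l : Type*} [Fintype κ] (M : Matrix ι κ ℂ) (N : Matrix κ l ℂ) :
    matConj (M * N) = matConj M * matConj N := Matrix.map_mul

lemma matConj_matConj {ι κ : Type*} (M : Matrix ι κ ℂ) : matConj (matConj M) = M := by
  ext; simp [matConj]

variable {r k m n : ℕ}

/-- The position of the unconjugated `j`-th matrix in a stack of length `2r`. -/
def plainIndex (j : Fin r) : Fin (2 * r) := ⟨r + j.rev, by omega⟩

/-- The position of the conjugated `j`-th matrix in a stack of length `2r`. -/
def conjIndex (j : Fin r) : Fin (2 * r) := ⟨j.rev, by omega⟩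

lemma eq_plainIndex_or_eq_conjIndex (p : Fin (2 * r)) :
    (∃ j : Fin r, p = plainIndex j) ∨ ∃ j : Fin r, p = conjIndex j := by
  by_cases h : (p : ℕ) < r
  · exact Or.inr ⟨Fin.rev ⟨p, h⟩, by simp [conjIndex]⟩
  · refine Or.inl ⟨Fin.rev ⟨p - r, by omega⟩, ?_⟩
    simp only [plainIndex, Fin.rev_rev, Fin.ext_iff]
    omega

/-- The sequence of length `2r` with `Y` in the conjugated and `X` in the plain positions. -/
def stack {α : Type*} (X Y : Fin r → α) (p : Fin (2 * r)) : α :=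
  if h : (p : ℕ) < r then Y (Fin.rev ⟨p, h⟩) else X (Fin.rev ⟨(p : ℕ) - r, by omega⟩)

lemma stack_plainIndex {α : Type*} (X Y : Fin r → α) (j : Fin r) :
    stack X Y (plainIndex j) = X j := by
  have h : ¬ ((plainIndex j : Fin (2 * r)) : ℕ) < r := Nat.not_lt.2 (Nat.le_add_right _ _)
  rw [stack, dif_neg h]
  refine congrArg X (Fin.ext ?_)
  simp only [plainIndex, Fin.val_rev]
  omega

lemma stack_conjIndex {α : Type*} (X Y : Fin r → α) (j : Fin r) :
    stack X Y (conjIndex j) = Y j := by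
  have h : ((conjIndex j : Fin (2 * r)) : ℕ) < r := j.rev.2
  rw [stack, dif_pos h]
  exact congrArg Y (Fin.rev_rev j)

lemma conjStack_plainIndex (M : Fin r → Matrix (Fin k) (Fin k) ℂ) (j : Fin r) :
    conjStack M (plainIndex j) = M j :=
  stack_plainIndex M (fun i => matConj (M i)) j

lemma conjStack_conjIndex (M : Fin r → Matrix (Fin k) (Fin k) ℂ) (j : Fin r) :
    conjStack M (conjIndex j) = matConj (M j) :=
  stack_conjIndex M (fun i => matConj (M i)) j

lemma finRotate_eq_of_val {N : ℕ} {p q : Fin N}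
    (h : (q : ℕ) = p + 1 ∨ ((p : ℕ) + 1 = N ∧ (q : ℕ) = 0)) : finRotate N p = q := by
  obtain _ | M := N
  · exact p.elim0
  rw [finRotate_apply, Fin.ext_iff, Fin.val_add_one]
  split_ifs with hp
  · rw [hp, Fin.val_last] at h
    omega
  · have : (p : ℕ) ≠ M := fun h' => hp (Fin.ext h')
    omega

/-- The cyclic system of length `2r` consists of the `r` equations without conjugation and the
`r` equations with conjugated coefficients, each half being continued by the other. -/
lemma isCyclicSolution_conjStack_iff (hr : 0 < r)
    {A C : Fin r → Matrix (Fin m) (Fin m) ℂ} {B D : Fin r → Matrix (Fin n) (Fin n) ℂ}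
    {Y : Fin (2 * r) → Matrix (Fin m) (Fin n) ℂ} :
    IsCyclicSolution (fun p => conjStack C (finRotate _ p)) (fun p => conjStack A (finRotate _ p))
      (fun p => conjStack D (finRotate _ p)) (fun p => conjStack B (finRotate _ p)) Y ↔
    ((∀ i j : Fin r, (j : ℕ) = i + 1 →
        A i * Y (plainIndex i) * B i = C i * Y (plainIndex j) * D i) ∧
      ∀ i : Fin r, (i : ℕ) + 1 = r →
        A i * Y (plainIndex i) * B i = C i * Y (conjIndex ⟨0, hr⟩) * D i) ∧
    (∀ i j : Fin r, (j : ℕ) = i + 1 → matConj (A i) * Y (conjIndex i) * matConj (B i) =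
        matConj (C i) * Y (conjIndex j) * matConj (D i)) ∧
      ∀ i : Fin r, (i : ℕ) + 1 = r → matConj (A i) * Y (conjIndex i) * matConj (B i) =
        matConj (C i) * Y (plainIndex ⟨0, hr⟩) * matConj (D i) := by
  have hpp : ∀ i j : Fin r, (j : ℕ) = i + 1 →
      finRotate (2 * r) (plainIndex j) = plainIndex i := fun i j h =>
    finRotate_eq_of_val (Or.inl (by simp only [plainIndex, Fin.val_rev]; omega))
  have hcc : ∀ i j : Fin r, (j : ℕ) = i + 1 →
      finRotate (2 * r) (conjIndex j) = conjIndex i := fun i j h =>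
    finRotate_eq_of_val (Or.inl (by simp only [conjIndex, Fin.val_rev]; omega))
  have hcp : ∀ i : Fin r, (i : ℕ) + 1 = r →
      finRotate (2 * r) (conjIndex ⟨0, hr⟩) = plainIndex i := fun i h =>
    finRotate_eq_of_val (Or.inl (by simp only [plainIndex, conjIndex, Fin.val_rev]; omega))
  have hpc : ∀ i : Fin r, (i : ℕ) + 1 = r →
      finRotate (2 * r) (plainIndex ⟨0, hr⟩) = conjIndex i := fun i h =>
    finRotate_eq_of_val (Or.inr (by simp only [plainIndex, conjIndex, Fin.val_rev]; omega))
  constructor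
  · intro h
    refine ⟨⟨fun i j hij => ?_, fun i hi => ?_⟩, fun i j hij => ?_, fun i hi => ?_⟩
    · simpa only [hpp i j hij, conjStack_plainIndex] using (h (plainIndex j)).symm
    · simpa only [hcp i hi, conjStack_plainIndex] using (h (conjIndex ⟨0, hr⟩)).symm
    · simpa only [hcc i j hij, conjStack_conjIndex] using (h (conjIndex j)).symm
    · simpa only [hpc i hi, conjStack_conjIndex] using (h (plainIndex ⟨0, hr⟩)).symm
  · rintro ⟨⟨h1, h2⟩, h3, h4⟩ p
    obtain ⟨⟨j, hj⟩, rfl⟩ | ⟨⟨j, hj⟩, rfl⟩ := eq_plainIndex_or_eq_conjIndex p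
    · obtain _ | j := j
      · let i : Fin r := ⟨r - 1, by omega⟩
        have hi : (i : ℕ) + 1 = r := Nat.sub_add_cancel hr
        simpa only [hpc i hi, conjStack_conjIndex] using (h4 i hi).symm
      · let i : Fin r := ⟨j, by omega⟩
        have hi := hpp i ⟨j + 1, hj⟩ rfl
        simpa only [hi, conjStack_plainIndex] using (h1 i ⟨j + 1, hj⟩ rfl).symm
    · obtain _ | j := j
      · let i : Fin r := ⟨r - 1, by omega⟩
        have hi : (i : ℕ) + 1 = r := Nat.sub_add_cancel hr
        simpa only [hcp i hi, conjStack_plainIndex] using (h2 i hi).symm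
      · let i : Fin r := ⟨j, by omega⟩
        have hi := hcc i ⟨j + 1, hj⟩ rfl
        simpa only [hi, conjStack_conjIndex] using (h3 i ⟨j + 1, hj⟩ rfl).symm

variable {hr : 0 < r} {A C : Fin r → Matrix (Fin m) (Fin m) ℂ}
  {B D : Fin r → Matrix (Fin n) (Fin n) ℂ}

/-- The symmetrization `X_i = c Y_i + conj (c Y_{i+r})` of a solution of the `ℂ`-linear cyclic
system. -/
lemma isConjPeriodicSolution_of_isCyclicSolution
    {Y : Fin (2 * r) → Matrix (Fin m) (Fin n) ℂ} (c : ℂ)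
    (hY : IsCyclicSolution (fun p => conjStack C (finRotate _ p))
      (fun p => conjStack A (finRotate _ p)) (fun p => conjStack D (finRotate _ p))
      (fun p => conjStack B (finRotate _ p)) Y) :
    IsConjPeriodicSolution hr A C B D
      fun i => c • Y (plainIndex i) + matConj (c • Y (conjIndex i)) := by
  obtain ⟨⟨h1, h2⟩, h3, h4⟩ := (isCyclicSolution_conjStack_iff hr).1 hY
  refine ⟨fun i j hij => ?_, fun i hi => ?_⟩
  · have e1 := h1 i j hij
    have e3 := congrArg matConj (h3 i j hij)
    simp only [matConj_mul, matConj_matConj] at e3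
    simp only [matConj_smul, Matrix.mul_add, Matrix.add_mul, Matrix.mul_smul, Matrix.smul_mul, e1,
      e3, sub_self]
  · have e2 := h2 i hi
    have e4 := congrArg matConj (h4 i hi)
    simp only [matConj_mul, matConj_matConj] at e4
    simp only [matConj_add, matConj_smul, matConj_matConj, Complex.conj_conj, Matrix.mul_add,
      Matrix.add_mul, Matrix.mul_smul, Matrix.smul_mul, e2, e4]
    rw [add_comm, sub_self]

/-- The system with conjugation, which is only `ℝ`-linear, has a nontrivial solution if and only if
the `ℂ`-linear cyclic system of twice the length has one. -/
lemma forall_isConjPeriodicSolution_eq_zero_iff :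
    (∀ X, IsConjPeriodicSolution hr A C B D X → ∀ i, X i = 0) ↔
      ¬ IsSingularSystem (fun p => conjStack C (finRotate _ p))
        (fun p => conjStack A (finRotate _ p)) (fun p => conjStack D (finRotate _ p))
        (fun p => conjStack B (finRotate _ p)) := by
  constructor
  · rintro h ⟨Y, hY0, hY⟩
    -- The symmetrizations for `c = 1` and `c = I` together determine `Y`.
    have e : ∀ i, Y (plainIndex i) + matConj (Y (conjIndex i)) = 0 ∧
        Y (plainIndex i) - matConj (Y (conjIndex i)) = 0 := by
      intro i
      have e1 := h _ (isConjPeriodicSolution_of_isCyclicSolution 1 hY) i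
      have e2 := h _ (isConjPeriodicSolution_of_isCyclicSolution Complex.I hY) i
      refine ⟨by simpa only [one_smul] using e1, ?_⟩
      rw [matConj_smul, Complex.conj_I, neg_smul, ← sub_eq_add_neg, ← smul_sub] at e2
      exact (smul_eq_zero.1 e2).resolve_left Complex.I_ne_zero
    have e' : ∀ i, Y (plainIndex i) = 0 := by
      intro i
      have : (2 : ℂ) • Y (plainIndex i) = 0 := by
        rw [two_smul]
        simpa using congrArg₂ (· + ·) (e i).1 (e i).2
      exact (smul_eq_zero.1 this).resolve_left two_ne_zero
    refine hY0 (funext fun p => ?_)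
    obtain ⟨j, rfl⟩ | ⟨j, rfl⟩ := eq_plainIndex_or_eq_conjIndex p
    · exact e' j
    · have := (e j).1
      rw [e' j, zero_add] at this
      rw [← matConj_matConj (Y (conjIndex j)), this]
      ext
      simp [matConj]
  · intro h X hX
    by_contra! hX0
    obtain ⟨i, hi⟩ := hX0
    refine h ⟨stack X fun i => matConj (X i), fun h0 => hi ?_, ?_⟩
    · rw [← stack_plainIndex X (fun i => matConj (X i)) i, h0]
      rfl
    · simp only [isCyclicSolution_conjStack_iff hr, stack_plainIndex, stack_conjIndex]
      refine ⟨⟨fun i j hij => sub_eq_zero.1 (hX.1 i j hij), fun i hi => sub_eq_zero.1 (hX.2 i hi)⟩,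
        fun i j hij => ?_, fun i hi => ?_⟩
      · simpa only [matConj_mul] using congrArg matConj (sub_eq_zero.1 (hX.1 i j hij))
      · simpa only [matConj_mul, matConj_matConj] using
          congrArg matConj (sub_eq_zero.1 (hX.2 i hi))

end Conjugation

theorem mainTheorem2 (r m n : ℕ) (hr : 0 < r) (hm : 0 < m) (hn : 0 < n)
    (A C : Fin r → Matrix (Fin m) (Fin m) ℂ) (B D : Fin r → Matrix (Fin n) (Fin n) ℂ) :
    (∀ X : Fin r → Matrix (Fin m) (Fin n) ℂ,
        IsConjPeriodicSolution hr A C B D X → ∀ i, X i = 0) ↔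
      (leftPencil A C).IsRegular ∧ (rightPencil B D).IsRegular ∧
        Disjoint (leftPencil A C).spectrum (rightPencil B D).spectrum := by
  rw [forall_isConjPeriodicSolution_eq_zero_iff]
  constructor
  · intro h
    by_contra h'
    exact h (isSingularSystem_of_pencils (by omega) hm hn h')
  · rintro ⟨hL, hR, hd⟩ ⟨X, hX0, hX⟩
    exact hX0 (eq_zero_of_isCyclicSolution hL hR hd hX)
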